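/- Let $R$ be a commutative ring with $1$. A $2$-graph is a countable category $\Lambda$ with a degree functor $d:\Lambda\to\mathbb N^2$ having the factorisation property: if $d(\lambda)=m+n$, there are unique $\mu,\nu\in\Lambda$ with $d(\mu)=m$, $d(\nu)=n$ and $\lambda=\mu\nu$. We call morphisms paths, write $r(\lambda)$ and $s(\lambda)$ for the codomain (range) and domain (source) of $\lambda$, identify each object (vertex) with its identity morphism, and write $\lambda(0,m)=\mu$, $\lambda(m,d(\lambda))=\nu$ and $\lambda(m)=s(\mu)$ in the situation above. For a vertex $v$ and $n\in\mathbb N^2$ let $\Lambda^n=d^{-1}(n)$, $v\Lambda^n=\{\lambda\in\Lambda^n: r(\lambda)=v\}$, $\Lambda^nv=\{\lambda\in\Lambda^n:s(\lambda)=v\}$, and $$\Lambda^{\le n}=\{\lambda: d(\lambda)\le n,\text{ and } d(\lambda)_i<n_i \text{ implies } s(\lambda)\Lambda^{e_i}=\emptyset\}.$$ $\Lambda$ is finite if $\Lambda^n$ is finite for every $n\in\mathbb N^2$. Paths of degree $(n_1,0)$ are called blue, and paths of degree $(0,n_2)$ red. A path $\lambda$ with $d(\lambda)\ne0$ is a cycle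 if $r(\lambda)=s(\lambda)$ and $\lambda(n)\neq s(\lambda)$ for $0<n<d(\lambda)$; a cycle $\lambda$ is isolated if for every $0<n\le d(\lambda)$ the sets $r(\lambda)\Lambda^n\setminus\{\lambda(0,n)\}$ and $\Lambda^n s(\lambda)\setminus\{\lambda(d(\lambda)-n,d(\lambda))\}$ are empty. The Kumjian–Pask algebra $\mathrm{KP}_R(\Lambda)$ is the (not necessarily unital) $R$-algebra generated by elements $s_\lambda,s_{\lambda^*}$ $(\lambda\in\Lambda)$, with $p_v:=s_v=s_{v^*}$ for vertices $v$, subject to the following relations: $p_vp_w=\delta_{v,w}p_v$ for all vertices $v,w$; $s_\lambda s_\mu=s_{\lambda\mu}$ and $s_{\mu^*}s_{\lambda^*}=s_{(\lambda\mu)^*}$ whenever $s(\lambda)=r(\mu)$, and $p_{r(\lambda)}s_\lambda=s_\lambda=s_\lambda p_{s(\lambda)}$ and $p_{s(\lambda)}s_{\lambda^*}=s_{\lambda^*}=s_{\lambda^*}p_{r(\lambda)}$ for all $\lambda$; $s_{\lambda^*}s_\mu=\delta_{\lambda,\mu}p_{s(\lambda)}$ for $\lambda,\mu\in\Lambda^{\le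 n}$, $n\ne0$; and $p_v=\sum_{\lambda\in\Lambda^{\le n},\,r(\lambda)=v}s_\lambda s_{\lambda^*}$ for all vertices $v$ and $n\neq0$. **Proposition 5.1.** Let $\Lambda$ be a finite $2$-graph such that no blue path is a cycle and each vertex is the range of an isolated red cycle. Let $S$ be the set of vertices $v$ with $v\Lambda^{(1,0)}=\emptyset$ (the sources of the blue graph), and suppose that there is a single isolated red cycle on which all the vertices of $S$ lie. Let $Y$ be the set of blue paths (including paths of degree $0$) whose source is in $S$. Then $Y$ is finite and $\mathrm{KP}_R(\Lambda)$ is isomorphic, as an $R$-algebra, to the matrix algebra $M_Y(R[x,x^{-1}])$ over the Laurent polynomial ring $R[x,x^{-1}]$. -/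

import Mathlib

open CategoryTheory

universe u w

/-- A `k`-graph with vertex set `V`: a countable category together with a degree functor to `ℕ^k`
having the factorisation property.

A morphism `f : a ⟶ b` is a path with source `s(f) = a` and range `r(f) = b`.  The product `μν` of
paths with `s(μ) = r(ν)` is therefore `ν ≫ μ`. -/
structure KGraph (k : ℕ) (V : Type u) [Category.{w} V] where
  /-- The degree map `d`. -/
  deg : ∀ {a b : V}, (a ⟶ b) → (Fin k → ℕ)
  deg_id : ∀ a : V, deg (𝟙 a) = 0
  deg_comp : ∀ {a b c : V} (ν : a ⟶ b) (μ : b ⟶ c), deg (ν ≫ μ) = deg μ + deg ν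
  /-- If `d(f) = m + n` then there are unique `μ`, `ν` with `d(μ) = m`, `d(ν) = n`, `f = μν`. -/
  factorisation : ∀ {a b : V} (f : a ⟶ b) (m n : Fin k → ℕ), deg f = m + n →
    ∃! p : (Σ c : V, (a ⟶ c) × (c ⟶ b)),
      deg p.2.2 = m ∧ deg p.2.1 = n ∧ f = p.2.1 ≫ p.2.2
  countable_vertices : Countable V
  countable_paths : ∀ a b : V, Countable (a ⟶ b)

namespace KGraph

/-- The set of all paths (morphisms) of a category, with source and range as data.  The identity
morphism at `v` is identified with the vertex `v`. -/
structure Path (V : Type u) [Category.{w} V] where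
  {source : V}
  {range : V}
  hom : source ⟶ range

variable {k : ℕ} {V : Type u} [Category.{w} V]

/-- `Λ` is finite: `Λ^n` is finite for every `n ∈ ℕ^k`. -/
def IsFinite (Λ : KGraph k V) : Prop :=
  ∀ n : Fin k → ℕ, {f : Path V | Λ.deg f.hom = n}.Finite

/-- `v Λ^n = ∅`: no path of degree `n` has range `v`. -/
def ReceivesNone (Λ : KGraph k V) (v : V) (n : Fin k → ℕ) : Prop :=
  ∀ (a : V) (f : a ⟶ v), Λ.deg f ≠ n

/-- `Λ^{≤ n}`: the paths `f` with `d(f) ≤ n` such that `d(f)_i < n_i` implies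
`s(f) Λ^{e_i} = ∅`. -/
def pathsLE (Λ : KGraph k V) (n : Fin k → ℕ) : Set (Path V) :=
  {f | Λ.deg f.hom ≤ n ∧ ∀ i, Λ.deg f.hom i < n i → Λ.ReceivesNone f.source (Pi.single i 1)}

/-- `v Λ^{≤ n}`. -/
def pathsLEAt (Λ : KGraph k V) (v : V) (n : Fin k → ℕ) : Set (Path V) :=
  {f | f.range = v ∧ f ∈ Λ.pathsLE n}

/-! ### The Kumjian-Pask algebra -/

/-- The letters: paths `f` and ghost paths `f*`.  Vertices are the identity paths. -/
inductive Letter (V : Type u) [Category.{w} V]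
  | path {a b : V} (f : a ⟶ b) : Letter V
  | ghost {a b : V} (f : a ⟶ b) : Letter V

section KumjianPask

variable (R : Type*) [CommRing R]

/-- The letter `f` in the free algebra. -/
noncomputable def freeS {a b : V} (f : a ⟶ b) : FreeAlgebra R (Letter V) :=
  FreeAlgebra.ι R (Letter.path f)

/-- The letter `f*` in the free algebra. -/
noncomputable def freeG {a b : V} (f : a ⟶ b) : FreeAlgebra R (Letter V) :=
  FreeAlgebra.ι R (Letter.ghost f)

/-- The vertex `v` in the free algebra. -/
noncomputable def freeP (v : V) : FreeAlgebra R (Letter V) :=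
  freeS R (𝟙 v)

/-- The Kumjian-Pask relations for a row-finite `k`-graph.  In `kp4` the set `v Λ^{≤ n}` is
always finite if the `k`-graph is row-finite. -/
inductive KPRel (Λ : KGraph k V) : FreeAlgebra R (Letter V) → FreeAlgebra R (Letter V) → Prop
  /-- `v* = v` for vertices `v`. -/
  | ghost_vertex (v : V) : KPRel Λ (freeG R (𝟙 v)) (freeP R v)
  /-- The vertices are mutually orthogonal idempotents. -/
  | kp1_idem (v : V) : KPRel Λ (freeP R v * freeP R v) (freeP R v)
  | kp1_orth (v v' : V) : v ≠ v' → KPRel Λ (freeP R v * freeP R v') 0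
  /-- `f g = fg` and `g* f* = (fg)*`. -/
  | kp2_path {a b c : V} (g : a ⟶ b) (f : b ⟶ c) :
      KPRel Λ (freeS R f * freeS R g) (freeS R (g ≫ f))
  | kp2_ghost {a b c : V} (g : a ⟶ b) (f : b ⟶ c) :
      KPRel Λ (freeG R g * freeG R f) (freeG R (g ≫ f))
  /-- `r(f) f = f = f s(f)` and `s(f) f* = f* = f* r(f)`. -/
  | kp2_range_path {a b : V} (f : a ⟶ b) : KPRel Λ (freeP R b * freeS R f) (freeS R f)
  | kp2_path_source {a b : V} (f : a ⟶ b) : KPRel Λ (freeS R f * freeP R a) (freeS R f)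
  | kp2_source_ghost {a b : V} (f : a ⟶ b) : KPRel Λ (freeP R a * freeG R f) (freeG R f)
  | kp2_ghost_range {a b : V} (f : a ⟶ b) : KPRel Λ (freeG R f * freeP R b) (freeG R f)
  /-- `f* g = δ_{f,g} s(f)` for `f, g ∈ Λ^{≤ n}`, `n ≠ 0`. -/
  | kp3_eq (n : Fin k → ℕ) (f : Path V) : n ≠ 0 → f ∈ Λ.pathsLE n →
      KPRel Λ (freeG R f.hom * freeS R f.hom) (freeP R f.source)
  | kp3_ne (n : Fin k → ℕ) (f g : Path V) : n ≠ 0 → f ∈ Λ.pathsLE n → g ∈ Λ.pathsLE n → f ≠ g →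
      KPRel Λ (freeG R f.hom * freeS R g.hom) 0
  /-- `v = ∑_{f ∈ v Λ^{≤ n}} f f*` for `n ≠ 0`. -/
  | kp4 (v : V) (n : Fin k → ℕ) : n ≠ 0 → ∀ h : (Λ.pathsLEAt v n).Finite,
      KPRel Λ (freeP R v) (∑ f ∈ h.toFinset, freeS R f.hom * freeG R f.hom)

/-- The Kumjian-Pask algebra `KP_R(Λ)`: the (not necessarily unital) `R`-algebra generated by
paths and ghost paths subject to the Kumjian-Pask relations.

The free non-unital algebra on the letters is the augmentation ideal (span of the nonempty words)
of the unital `FreeAlgebra`, and all relations lie in it.  So its quotient by the ideal generated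
by the relations is the non-unital subalgebra generated by the letters in the corresponding quotient
of the unital free algebra. -/
abbrev KumjianPask (Λ : KGraph k V) :
    NonUnitalSubalgebra R (RingQuot (KPRel R Λ)) :=
  NonUnitalAlgebra.adjoin R
    (Set.range fun x : Letter V => RingQuot.mkAlgHom R (KPRel R Λ) (FreeAlgebra.ι R x))

end KumjianPask

/-! ### Cycles -/

/-- A path `f` with `r(f) = s(f) = v` is a cycle if `d(f) ≠ 0` and `f(n) ≠ s(f)` for
`0 < n < d(f)`.  Here `f(n)` is the vertex `c` in the factorisation `f = μν` with `d(μ) = n`,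
`c = s(μ)`. -/
def IsCycle (Λ : KGraph k V) {v : V} (f : v ⟶ v) : Prop :=
  Λ.deg f ≠ 0 ∧
    ∀ (c : V) (ν : v ⟶ c) (μ : c ⟶ v), f = ν ≫ μ → 0 < Λ.deg μ → Λ.deg μ < Λ.deg f → c ≠ v

/-- A cycle `f` is isolated if for every `0 < n ≤ d(f)` the only path of degree `n` with range
`r(f)` is the initial segment `f(0, n)` and the only path of degree `n` with source `s(f)` is the
final segment `f(d(f) - n, d(f))`.  In a factorisation `f = μν`, `μ` is the initial segment
of its degree and `ν` is the final segment of its degree. -/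
def IsIsolatedCycle (Λ : KGraph k V) {v : V} (f : v ⟶ v) : Prop :=
  Λ.IsCycle f ∧
    ∀ (c : V) (ν : v ⟶ c) (μ : c ⟶ v), f = ν ≫ μ →
      (0 < Λ.deg μ → ∀ (a : V) (g : a ⟶ v), Λ.deg g = Λ.deg μ → Path.mk g = Path.mk μ) ∧
      (0 < Λ.deg ν → ∀ (b : V) (g : v ⟶ b), Λ.deg g = Λ.deg ν → Path.mk g = Path.mk ν)

/-! ### Blue and red paths in a 2-graph -/

/-- Blue paths: those of degree `(n₁, 0)`. -/
def IsBlue (Λ : KGraph 2 V) {a b : V} (f : a ⟶ b) : Prop := Λ.deg f 1 = 0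

/-- Red paths: those of degree `(0, n₂)`. -/
def IsRed (Λ : KGraph 2 V) {a b : V} (f : a ⟶ b) : Prop := Λ.deg f 0 = 0

/-- The sources of the blue graph: the vertices `v` which receive no blue edge, `v Λ^{e_1} = ∅`. -/
def blueSources (Λ : KGraph 2 V) : Set V :=
  {v | Λ.ReceivesNone v (Pi.single 0 1)}

/-- The set `Y` of blue paths whose source is a source of the blue graph. -/
def bluePathsFromSources (Λ : KGraph 2 V) : Set (Path V) :=
  {f | Λ.IsBlue f.hom ∧ f.source ∈ Λ.blueSources}

end KGraph

/-! Isolation makes the red structure rigid: every vertex receives exactly one red path of each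
length (`uniqueRed_of_isolated`). Let `f` be a path and `y` a blue path from a blue source with
range `s(f)`. Then `fy` factors uniquely as `zρ` with `z` blue and `ρ` red, and `z` again starts at
a blue source. So `f` acts injectively on blue paths from sources by `y ↦ z`. The red part `ρ` runs
along the common cycle, and its winding number `wt` is a cocycle.

Sending `f` to the sum over `y` of `x ^ wt` times the matrix unit at `(z, y)`, and `f*` to the
inverse partial monomial matrix, respects the Kumjian-Pask relations. The delicate ones, `kp3_ne`
and `kp4`, rest on `eq_of_act_eq` and `exists_act_eq`.

For bijectivity, the elements `unitElt` map to the matrix units times powers of `x`, which form an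
`R`-basis (`rep_unitElt`), and they span the algebra (`le_unitSpan`). Spanning uses two facts: each
vertex is the sum of `y y*` over its source paths, since blue paths have bounded length, and `ρ ρ* =
r(ρ)` for `ρ` red. -/

namespace KGraph

variable {V : Type u} [Category.{w} V]

/-! ### Unique factorisation and powers of closed paths -/

section Factorisation

variable {k : ℕ} (Λ : KGraph k V)

theorem exists_factor {a b : V} (f : a ⟶ b) (m n : Fin k → ℕ) (h : Λ.deg f = m + n) :
    ∃ (c : V) (ν : a ⟶ c) (μ : c ⟶ b), Λ.deg μ = m ∧ Λ.deg ν = n ∧ f = ν ≫ μ := by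
  obtain ⟨⟨c, ν, μ⟩, h, -⟩ := Λ.factorisation f m n h
  exact ⟨c, ν, μ, h⟩

theorem factor_unique {a b c c' : V} {ν : a ⟶ c} {μ : c ⟶ b} {ν' : a ⟶ c'} {μ' : c' ⟶ b}
    (h : ν ≫ μ = ν' ≫ μ') (hd : Λ.deg μ = Λ.deg μ') :
    (⟨c, ν, μ⟩ : Σ c : V, (a ⟶ c) × (c ⟶ b)) = ⟨c', ν', μ'⟩ := by
  have hn : Λ.deg ν = Λ.deg ν' := by
    have := congrArg Λ.deg h
    rw [Λ.deg_comp, Λ.deg_comp, hd] at this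
    exact add_left_cancel this
  exact (Λ.factorisation (ν ≫ μ) _ _ (Λ.deg_comp ν μ)).unique ⟨rfl, rfl, rfl⟩
    ⟨hd.symm, hn.symm, h⟩

theorem eq_id_of_deg_eq_zero {a b : V} (f : a ⟶ b) (h : Λ.deg f = 0) :
    (⟨a, f⟩ : Σ a : V, a ⟶ b) = ⟨b, 𝟙 b⟩ := by
  have := Λ.factor_unique (show f ≫ 𝟙 b = 𝟙 a ≫ f by simp) (by rw [Λ.deg_id, h])
  cases this
  rfl

theorem finite_vertices (hfin : Λ.IsFinite) : Finite V := by
  have := (hfin 0).to_subtype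
  refine Finite.of_injective
    (fun v => (⟨⟨𝟙 v⟩, Λ.deg_id v⟩ : {f : Path V | Λ.deg f.hom = 0})) fun v v' h => ?_
  exact congrArg (fun p => p.1.source) h

/-- Iterates of a closed path. -/
def loopPow {v : V} (f : v ⟶ v) : ℕ → (v ⟶ v)
  | 0 => 𝟙 v
  | n + 1 => f ≫ loopPow f n

theorem loopPow_add {v : V} (f : v ⟶ v) (m n : ℕ) :
    loopPow f (m + n) = loopPow f m ≫ loopPow f n := by
  induction m with
  | zero => simp [loopPow]
  | succ m ih => rw [Nat.succ_add, loopPow, ih, loopPow, Category.assoc]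

theorem deg_loopPow {v : V} (f : v ⟶ v) (n : ℕ) : Λ.deg (loopPow f n) = n • Λ.deg f := by
  induction n with
  | zero => simp [loopPow, Λ.deg_id]
  | succ n ih => rw [loopPow, Λ.deg_comp, ih, succ_nsmul]

end Factorisation

/-! ### Uniqueness of red paths, and blue sources -/

variable (Λ : KGraph 2 V)

theorem deg_comp_apply {a b c : V} (ν : a ⟶ b) (μ : b ⟶ c) (i : Fin 2) :
    Λ.deg (ν ≫ μ) i = Λ.deg μ i + Λ.deg ν i := by
  rw [Λ.deg_comp, Pi.add_apply]

/-- Every vertex is the range of exactly one red path of each length. -/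
def UniqueRed (Λ : KGraph 2 V) : Prop :=
  ∀ (v : V) (m : ℕ), ∃! p : (Σ a : V, a ⟶ v), Λ.deg p.2 = ![0, m]

variable {Λ}

theorem IsRed.deg_eq {a b : V} {f : a ⟶ b} (h : Λ.IsRed f) : Λ.deg f = ![0, Λ.deg f 1] := by
  funext i; fin_cases i
  · exact h
  · rfl

theorem IsBlue.deg_eq {a b : V} {f : a ⟶ b} (h : Λ.IsBlue f) : Λ.deg f = ![Λ.deg f 0, 0] := by
  funext i; fin_cases i
  · rfl
  · exact h

theorem isRed_id (a : V) : Λ.IsRed (𝟙 a) := by simp [IsRed, Λ.deg_id]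

theorem IsRed.comp {a b c : V} {f : a ⟶ b} {g : b ⟶ c} (hf : Λ.IsRed f) (hg : Λ.IsRed g) :
    Λ.IsRed (f ≫ g) := by
  unfold IsRed at *; rw [deg_comp_apply, hf, hg]

theorem isRed_loopPow {v : V} {f : v ⟶ v} (h : Λ.IsRed f) (n : ℕ) : Λ.IsRed (loopPow f n) := by
  unfold IsRed at *; simp [deg_loopPow, h]

/-- Existence comes from initial segments of powers of the cycle at `v`. For uniqueness, isolation
forces the red edge into `v` to be the first edge of the cycle; strip that edge and induct on the
length. -/
theorem uniqueRed_of_isolated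
    (hred : ∀ v : V, ∃ f : v ⟶ v, Λ.IsRed f ∧ Λ.IsIsolatedCycle f) : Λ.UniqueRed := by
  have hpos : ∀ {v : V} {f : v ⟶ v}, Λ.IsRed f → Λ.IsIsolatedCycle f → 0 < Λ.deg f 1 := by
    intro v f hf hi
    refine Nat.pos_of_ne_zero fun h0 => hi.1.1 ?_
    rw [hf.deg_eq, h0]; simp
  have hex : ∀ (v : V) (m : ℕ), ∃ p : (Σ a : V, a ⟶ v), Λ.deg p.2 = ![0, m] := by
    intro v m
    obtain ⟨f, hf, hi⟩ := hred v
    have hp := hpos hf hi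
    obtain ⟨c, ν, μ, hμ, -, -⟩ := Λ.exists_factor (loopPow f m) ![0, m]
      ![0, m * Λ.deg f 1 - m] (by
        rw [deg_loopPow, hf.deg_eq]
        have : m ≤ m * Λ.deg f 1 := Nat.le_mul_of_pos_right m hp
        funext i; fin_cases i
        · simp
        · simp; omega)
    exact ⟨⟨c, μ⟩, hμ⟩
  have huniq : ∀ (m : ℕ) (v : V) (p q : (Σ a : V, a ⟶ v)), Λ.deg p.2 = ![0, m] →
      Λ.deg q.2 = ![0, m] → p = q := by
    intro m
    induction m with
    | zero =>
      rintro v ⟨a, p⟩ ⟨b, q⟩ hp hq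
      rw [Λ.eq_id_of_deg_eq_zero p (by rw [hp]; simp [funext_iff, Fin.forall_fin_two]),
        Λ.eq_id_of_deg_eq_zero q (by rw [hq]; simp [funext_iff, Fin.forall_fin_two])]
    | succ m ih =>
      rintro v ⟨a, p⟩ ⟨b, q⟩ hp hq
      have hs : (![0, m + 1] : Fin 2 → ℕ) = ![0, 1] + ![0, m] := by
        funext i; fin_cases i <;> simp [add_comm]
      obtain ⟨c, p₁, p₀, hp₀, hp₁, rfl⟩ := Λ.exists_factor p _ _ (hp.trans hs)
      obtain ⟨d, q₁, q₀, hq₀, hq₁, rfl⟩ := Λ.exists_factor q _ _ (hq.trans hs)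
      obtain ⟨f, hf, hi⟩ := hred v
      have hp := hpos hf hi
      obtain ⟨e, ν, μ, hμ, -, rfl⟩ := Λ.exists_factor f ![0, 1] ![0, Λ.deg f 1 - 1] (by
        rw [hf.deg_eq]; funext i; fin_cases i
        · simp
        · simp; omega)
      have hμ0 : 0 < Λ.deg μ := by
        rw [hμ, Pi.lt_def]
        exact ⟨fun i => Nat.zero_le _, 1, by simp⟩
      have h := (hi.2 e ν μ rfl).1 hμ0
      cases h c p₀ (hp₀.trans hμ.symm)
      cases h d q₀ (hq₀.trans hμ.symm)
      cases ih _ ⟨a, p₁⟩ ⟨b, q₁⟩ hp₁ hq₁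
      rfl
  intro v m
  obtain ⟨p, hp⟩ := hex v m
  exact ⟨p, hp, fun q hq => huniq m v q p hq hp⟩

theorem UniqueRed.eq (hU : Λ.UniqueRed) {a b v : V} {p : a ⟶ v} {q : b ⟶ v} (hp : Λ.IsRed p)
    (hq : Λ.IsRed q) (h : Λ.deg p 1 = Λ.deg q 1) : (⟨a, p⟩ : Σ a : V, a ⟶ v) = ⟨b, q⟩ :=
  (hU v (Λ.deg q 1)).unique (by rw [hp.deg_eq, ← h]) hq.deg_eq

theorem UniqueRed.eq_hom (hU : Λ.UniqueRed) {a v : V} {p q : a ⟶ v} (hp : Λ.IsRed p)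
    (hq : Λ.IsRed q) (h : Λ.deg p 1 = Λ.deg q 1) : p = q := by
  cases hU.eq hp hq h; rfl

theorem UniqueRed.exists_red (hU : Λ.UniqueRed) (v : V) (m : ℕ) :
    ∃ (a : V) (p : a ⟶ v), Λ.IsRed p ∧ Λ.deg p 1 = m := by
  obtain ⟨⟨a, p⟩, hp, -⟩ := hU v m
  exact ⟨a, p, by simp [IsRed, hp], by simp [hp]⟩

theorem UniqueRed.not_receivesNone (hU : Λ.UniqueRed) (v : V) :
    ¬ Λ.ReceivesNone v (Pi.single 1 1) := by
  intro h
  obtain ⟨⟨a, p⟩, hp, -⟩ := hU v 1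
  exact h a p (by rw [hp]; funext i; fin_cases i <;> simp)

/-- A blue edge into `b`, preceded by a red path of the length of `ρ`, can be refactored with its
red part next to `b`. That red part must be `ρ`, so a blue edge into `a` remains. -/
theorem blueSources_of_red_out (hU : Λ.UniqueRed) {a b : V} {ρ : a ⟶ b} (hρ : Λ.IsRed ρ)
    (ha : a ∈ Λ.blueSources) : b ∈ Λ.blueSources := by
  intro c h hh
  obtain ⟨d, g, hg, hg1⟩ := hU.exists_red c (Λ.deg ρ 1)
  obtain ⟨e, h', g', hg', hh', -⟩ := Λ.exists_factor (g ≫ h) (Λ.deg ρ) (Pi.single 0 1) (by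
    rw [Λ.deg_comp, hh, hg.deg_eq, hg1, hρ.deg_eq, add_comm]; rfl)
  cases hU.eq (p := g') (q := ρ) (by simpa [IsRed, hg'] using hρ) hρ (by rw [hg'])
  exact ha _ h' hh'

theorem blueSources_of_red_in {a b : V} {ρ : a ⟶ b} (hb : b ∈ Λ.blueSources) :
    a ∈ Λ.blueSources := by
  intro c h hh
  obtain ⟨e, ν, μ, hμ, -, -⟩ := Λ.exists_factor (h ≫ ρ) (Pi.single 0 1) (Λ.deg ρ) (by
    rw [Λ.deg_comp, hh, add_comm])
  exact hb _ μ hμ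

theorem deg_zero_of_blueSources {a b : V} (f : a ⟶ b) (hb : b ∈ Λ.blueSources) :
    Λ.deg f 0 = 0 := by
  by_contra h0
  obtain ⟨c, ν, μ, hμ, -, -⟩ := Λ.exists_factor f (Pi.single 0 1) (Λ.deg f - Pi.single 0 1) (by
    funext i; fin_cases i
    · simp; omega
    · simp)
  exact hb _ μ hμ

/-! ### Blue paths have bounded length -/

/-- A closed blue path of positive length that is not a cycle returns to its base earlier, which
gives a shorter such path. -/
theorem deg_eq_zero_of_blue_closed (hblue : ∀ (v : V) (f : v ⟶ v), Λ.IsBlue f → ¬ Λ.IsCycle f)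
    {v : V} (f : v ⟶ v) (hf : Λ.IsBlue f) : Λ.deg f 0 = 0 := by
  induction hn : Λ.deg f 0 using Nat.strong_induction_on generalizing f with
  | _ n ih =>
    by_contra hne
    refine hblue v f hf ⟨fun h => hne (by rw [← hn, h]; rfl), ?_⟩
    rintro c ν μ rfl hμ hlt rfl
    have hμb : Λ.IsBlue μ := Nat.le_zero.1 ((hlt.le 1).trans (le_of_eq hf))
    have h0 : Λ.deg μ 0 < n := by
      have h1 := hlt.le 0
      refine lt_of_le_of_ne (hn ▸ h1) fun h => hlt.ne ?_
      rw [hμb.deg_eq, hf.deg_eq, hn, h]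
    have := ih _ h0 μ hμb rfl
    exact hμ.ne' (by rw [hμb.deg_eq, this]; simp)

/-- The set `D b` of vertices with a nontrivial blue path to `b` grows strictly along each blue edge
`c ⟶ b`: it gains `c`, which is not in `D c` for want of closed blue paths. -/
theorem blue_length_le [Fintype V]
    (hblue : ∀ (v : V) (f : v ⟶ v), Λ.IsBlue f → ¬ Λ.IsCycle f)
    {a b : V} (f : a ⟶ b) (hf : Λ.IsBlue f) : Λ.deg f 0 ≤ Fintype.card V := by
  classical
  let D : V → Finset V := fun b =>
    Finset.univ.filter fun w => ∃ g : w ⟶ b, Λ.IsBlue g ∧ Λ.deg g 0 ≠ 0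
  suffices ∀ (m : ℕ) {a b : V} (f : a ⟶ b), Λ.IsBlue f → Λ.deg f 0 = m → m ≤ (D b).card from
    (this _ f hf rfl).trans (Finset.card_le_univ _)
  intro m
  induction m with
  | zero => intros; exact Nat.zero_le _
  | succ m ih =>
    intro a b f hf hm
    obtain ⟨c, ν, μ, hμ, hν, -⟩ := Λ.exists_factor f ![1, 0] ![m, 0] (by
      rw [hf.deg_eq, hm]; funext i; fin_cases i <;> simp [add_comm])
    refine Nat.succ_le_of_lt ((ih ν (by simp [IsBlue, hν]) (by simp [hν])).trans_lt
      (Finset.card_lt_card (Finset.ssubset_iff_of_subset ?_ |>.2 ⟨c, ?_, ?_⟩)))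
    · intro w hw
      obtain ⟨g, hg, hg0⟩ := (Finset.mem_filter.1 hw).2
      refine Finset.mem_filter.2 ⟨Finset.mem_univ _, g ≫ μ, ?_, ?_⟩
      · unfold IsBlue at *; simp [deg_comp_apply, hg, hμ]
      · simp [deg_comp_apply, hμ]
    · exact Finset.mem_filter.2 ⟨Finset.mem_univ _, μ, by simp [IsBlue, hμ], by simp [hμ]⟩
    · intro hc
      obtain ⟨g, hg, hg0⟩ := (Finset.mem_filter.1 hc).2
      exact hg0 (deg_eq_zero_of_blue_closed hblue g hg)

/-! ### The action on blue paths from sources -/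

/-- A blue path with range `a` whose source is a source of the blue graph. -/
structure SourcePath (Λ : KGraph 2 V) (a : V) where
  src : V
  hom : src ⟶ a
  blue : Λ.IsBlue hom
  src_mem : src ∈ Λ.blueSources

theorem SourcePath.eq_of_hom {a : V} {y z : Λ.SourcePath a}
    (h : (⟨y.src, y.hom⟩ : Σ c : V, c ⟶ a) = ⟨z.src, z.hom⟩) : y = z := by
  cases y; cases z; cases h; rfl

/-- The vertex `a` as a path from a source. -/
def SourcePath.id {a : V} (ha : a ∈ Λ.blueSources) : Λ.SourcePath a :=
  ⟨a, 𝟙 a, by simp [IsBlue, Λ.deg_id], ha⟩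

theorem SourcePath.eq_id {a : V} (ha : a ∈ Λ.blueSources) (y : Λ.SourcePath a) :
    y = SourcePath.id ha := by
  refine SourcePath.eq_of_hom (Λ.eq_id_of_deg_eq_zero y.hom ?_)
  rw [y.blue.deg_eq, deg_zero_of_blueSources y.hom ha]; simp

theorem finite_sourcePath (hfin : Λ.IsFinite)
    (hblue : ∀ (v : V) (f : v ⟶ v), Λ.IsBlue f → ¬ Λ.IsCycle f) (a : V) :
    Finite (Λ.SourcePath a) := by
  have := Λ.finite_vertices hfin
  have := Fintype.ofFinite V
  have hf : (⋃ n ∈ Set.Iic (Fintype.card V), {f : Path V | Λ.deg f.hom = ![n, 0]}).Finite :=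
    (Set.finite_Iic _).biUnion fun n _ => hfin _
  have := hf.to_subtype
  refine Finite.of_injective (fun y : Λ.SourcePath a =>
    (⟨⟨y.hom⟩, Set.mem_biUnion (x := Λ.deg y.hom 0) (blue_length_le hblue y.hom y.blue)
      y.blue.deg_eq⟩ :
      (⋃ n ∈ Set.Iic (Fintype.card V), {f : Path V | Λ.deg f.hom = ![n, 0]} : Set (Path V)))) ?_
  rintro ⟨s, y, _, _⟩ ⟨t, z, _, _⟩ h
  cases congrArg Subtype.val h
  rfl

theorem exists_act (hU : Λ.UniqueRed) {a b : V} (f : a ⟶ b) (y : Λ.SourcePath a) :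
    ∃ p : (Σ z : Λ.SourcePath b, y.src ⟶ z.src), Λ.IsRed p.2 ∧ y.hom ≫ f = p.2 ≫ p.1.hom := by
  obtain ⟨c, ρ, z, hz, hρ, h⟩ := Λ.exists_factor (y.hom ≫ f)
    ![Λ.deg f 0 + Λ.deg y.hom 0, 0] ![0, Λ.deg f 1] (by
      have := y.blue
      unfold IsBlue at this
      rw [Λ.deg_comp]; funext i; fin_cases i <;> simp [this])
  have hr : Λ.IsRed ρ := by simp [IsRed, hρ]
  exact ⟨⟨⟨c, z, by simp [IsBlue, hz], blueSources_of_red_out hU hr y.src_mem⟩, ρ⟩, hr, h⟩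

theorem act_unique {b s : V} {z z' : Λ.SourcePath b} {ρ : s ⟶ z.src} {ρ' : s ⟶ z'.src}
    (hρ : Λ.IsRed ρ) (hρ' : Λ.IsRed ρ') (h : ρ ≫ z.hom = ρ' ≫ z'.hom) :
    (⟨z, ρ⟩ : Σ z : Λ.SourcePath b, s ⟶ z.src) = ⟨z', ρ'⟩ := by
  obtain ⟨c, z, hz, _⟩ := z
  obtain ⟨c', z', hz', _⟩ := z'
  have h0 := congrArg (fun g => Λ.deg g 0) h
  simp only [deg_comp_apply] at h0
  unfold IsRed at hρ hρ'
  cases Λ.factor_unique h (by rw [hz.deg_eq, hz'.deg_eq]; congr 1; omega)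
  rfl

end KGraph

/-! ### The action of paths on blue paths from sources -/

namespace KGraph

variable {V : Type u} [Category.{w} V] {Λ : KGraph 2 V}

/-- The blue part of `f y`, for a path `f` with source `a` and a blue path `y` with range `a`. -/
noncomputable def act (hU : Λ.UniqueRed) {a b : V} (f : a ⟶ b) (y : Λ.SourcePath a) :
    Λ.SourcePath b :=
  (exists_act hU f y).choose.1

/-- The red part of `f y`. -/
noncomputable def actRed (hU : Λ.UniqueRed) {a b : V} (f : a ⟶ b) (y : Λ.SourcePath a) :
    y.src ⟶ (act hU f y).src :=
  (exists_act hU f y).choose.2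

section Act

variable (hU : Λ.UniqueRed)

theorem isRed_actRed {a b : V} (f : a ⟶ b) (y : Λ.SourcePath a) : Λ.IsRed (actRed hU f y) :=
  (exists_act hU f y).choose_spec.1

theorem actRed_comp {a b : V} (f : a ⟶ b) (y : Λ.SourcePath a) :
    y.hom ≫ f = actRed hU f y ≫ (act hU f y).hom :=
  (exists_act hU f y).choose_spec.2

theorem act_eq {a b : V} {f : a ⟶ b} {y : Λ.SourcePath a} {z : Λ.SourcePath b}
    {ρ : y.src ⟶ z.src} (hρ : Λ.IsRed ρ) (h : y.hom ≫ f = ρ ≫ z.hom) : act hU f y = z :=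
  congrArg Sigma.fst (act_unique (isRed_actRed hU f y) hρ ((actRed_comp hU f y).symm.trans h))

theorem act_id {a : V} (y : Λ.SourcePath a) : act hU (𝟙 a) y = y :=
  act_eq hU (isRed_id _) (by simp)

theorem act_comp {a b c : V} (g : a ⟶ b) (f : b ⟶ c) (y : Λ.SourcePath a) :
    act hU (g ≫ f) y = act hU f (act hU g y) :=
  act_eq hU ((isRed_actRed hU g y).comp (isRed_actRed hU f _)) (by
    rw [Category.assoc, ← actRed_comp, ← Category.assoc, actRed_comp hU g, Category.assoc])

theorem deg_actRed {a b : V} (f : a ⟶ b) (y : Λ.SourcePath a) :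
    Λ.deg (actRed hU f y) 1 = Λ.deg f 1 := by
  have h := congrArg (fun g => Λ.deg g 1) (actRed_comp hU f y)
  have h1 := y.blue
  have h2 := (act hU f y).blue
  simp only [deg_comp_apply, IsBlue] at h h1 h2
  omega

include hU in
theorem deg_one_of_mem_pathsLE {n : Fin 2 → ℕ} {f : Path V} (hf : f ∈ Λ.pathsLE n) :
    Λ.deg f.hom 1 = n 1 := by
  by_contra h
  exact hU.not_receivesNone _ (hf.2 1 (lt_of_le_of_ne (hf.1 1) h))

include hU in
theorem comp_eq_of_red_of_eq {s t b : V} {x x' : Λ.SourcePath b} {ρ : s ⟶ x.src}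
    {σ : t ⟶ x'.src} (hρ : Λ.IsRed ρ) (hσ : Λ.IsRed σ) (hd : Λ.deg ρ 1 = Λ.deg σ 1)
    (h : x = x') : (⟨s, ρ ≫ x.hom⟩ : Σ c : V, c ⟶ b) = ⟨t, σ ≫ x'.hom⟩ := by
  subst h
  cases hU.eq hρ hσ hd
  rfl

/-- If the red degrees agree and the actions meet then the paths `f y` and `g z` agree. -/
theorem comp_eq_of_act_eq {a a' b : V} {f : a ⟶ b} {g : a' ⟶ b} (hd : Λ.deg f 1 = Λ.deg g 1)
    {y : Λ.SourcePath a} {z : Λ.SourcePath a'} (h : act hU f y = act hU g z) :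
    (⟨y.src, y.hom ≫ f⟩ : Σ c : V, c ⟶ b) = ⟨z.src, z.hom ≫ g⟩ := by
  have hy := actRed_comp hU f y
  have hz := actRed_comp hU g z
  have dy := deg_actRed hU f y
  have dz := deg_actRed hU g z
  rw [hy, hz]
  exact comp_eq_of_red_of_eq hU (isRed_actRed hU f y) (isRed_actRed hU g z)
    (dy.trans (hd.trans dz.symm)) h

theorem eq_of_comp_eq {a a' b : V} {f : a ⟶ b} {g : a' ⟶ b} (hd : Λ.deg f = Λ.deg g)
    {y : Λ.SourcePath a} {z : Λ.SourcePath a'}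
    (h : (⟨y.src, y.hom ≫ f⟩ : Σ c : V, c ⟶ b) = ⟨z.src, z.hom ≫ g⟩) :
    (⟨⟨f⟩, y⟩ : Σ p : Path V, Λ.SourcePath p.source) = ⟨⟨g⟩, z⟩ := by
  obtain ⟨s, y, hy, _⟩ := y
  obtain ⟨t, z, hz, _⟩ := z
  obtain ⟨rfl, h⟩ := Sigma.mk.inj_iff.1 h
  cases Λ.factor_unique (eq_of_heq h) hd
  rfl

theorem act_injective {a b : V} (f : a ⟶ b) : Function.Injective (act hU f) := by
  intro y z h
  have := eq_of_comp_eq rfl (comp_eq_of_act_eq hU rfl h)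
  exact eq_of_heq (Sigma.mk.inj_iff.1 this).2

/-- No vertex is a red source, so `f` and `g` both have red degree `n 1`, whence `fy = gz`. If one
of them has blue degree below `n 0`, its source is a blue source and the path it acts on is trivial;
comparing total blue degrees then gives `d(f) = d(g)`. -/
theorem eq_of_act_eq {n : Fin 2 → ℕ} {a a' b : V} {f : a ⟶ b} {g : a' ⟶ b}
    (hf : Path.mk f ∈ Λ.pathsLE n) (hg : Path.mk g ∈ Λ.pathsLE n)
    {y : Λ.SourcePath a} {z : Λ.SourcePath a'} (h : act hU f y = act hU g z) :
    (⟨⟨f⟩, y⟩ : Σ p : Path V, Λ.SourcePath p.source) = ⟨⟨g⟩, z⟩ := by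
  have hf1 := deg_one_of_mem_pathsLE hU hf
  have hg1 := deg_one_of_mem_pathsLE hU hg
  have hc := comp_eq_of_act_eq hU (hf1.trans hg1.symm) h
  refine eq_of_comp_eq ?_ hc
  have h0 : Λ.deg f 0 + Λ.deg y.hom 0 = Λ.deg g 0 + Λ.deg z.hom 0 := by
    have := congrArg (fun p => Λ.deg p.2 0) hc
    simpa only [deg_comp_apply] using this
  have hf0 : Λ.deg f 0 ≤ n 0 := hf.1 0
  have hg0 : Λ.deg g 0 ≤ n 0 := hg.1 0
  have hy0 : Λ.deg f 0 < n 0 → Λ.deg y.hom 0 = 0 := fun hlt =>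
    deg_zero_of_blueSources y.hom (hf.2 0 hlt)
  have hz0 : Λ.deg g 0 < n 0 → Λ.deg z.hom 0 = 0 := fun hlt =>
    deg_zero_of_blueSources z.hom (hg.2 0 hlt)
  funext i
  fin_cases i
  · change Λ.deg f 0 = Λ.deg g 0
    omega
  · exact hf1.trans hg1.symm

/-- Extend `x` at its source by the red path of length `n 1` and let `f` be the initial segment with
as much blue degree as `n 0` allows. If the blue degree of `x` runs out, what is left is a vertex,
and it is a blue source. -/
theorem exists_act_eq {v : V} (x : Λ.SourcePath v) (n : Fin 2 → ℕ) :
    ∃ (a : V) (f : a ⟶ v) (y : Λ.SourcePath a), Path.mk f ∈ Λ.pathsLE n ∧ act hU f y = x := by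
  obtain ⟨s, ρ, hρ, hρ1⟩ := hU.exists_red x.src (n 1)
  have hs : s ∈ Λ.blueSources := blueSources_of_red_in (ρ := ρ) x.src_mem
  obtain ⟨a, y, f, hf, hy, h⟩ := Λ.exists_factor (ρ ≫ x.hom) ![min (Λ.deg x.hom 0) (n 0), n 1]
    ![Λ.deg x.hom 0 - n 0, 0] (by
      have := x.blue
      unfold IsBlue at this
      unfold IsRed at hρ
      rw [Λ.deg_comp]; funext i; fin_cases i
      · simp [hρ]; omega
      · simp [this, hρ1])
  refine ⟨a, f, ⟨s, y, by simp [IsBlue, hy], hs⟩, ⟨?_, ?_⟩, act_eq hU hρ h.symm⟩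
  · intro i; fin_cases i <;> simp [hf]
  · intro i hi
    fin_cases i
    · have h1 : Λ.deg y = 0 := by
        simp [hf] at hi
        rw [hy]; funext i; fin_cases i
        · simp; omega
        · simp
      cases Λ.eq_id_of_deg_eq_zero y h1
      exact hs
    · simp [hf] at hi

end Act

/-! ### Winding numbers around the cycle of sources -/

/-- A red closed path `cycle` through all sources of the blue graph. -/
structure SourceCycle (Λ : KGraph 2 V) where
  base : V
  cycle : base ⟶ base
  isRed_cycle : Λ.IsRed cycle
  length_pos : 0 < Λ.deg cycle 1
  dvd_of_closed : ∀ g : base ⟶ base, Λ.IsRed g → Λ.deg cycle 1 ∣ Λ.deg g 1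
  out : ∀ c ∈ Λ.blueSources, base ⟶ c
  back : ∀ c ∈ Λ.blueSources, c ⟶ base
  isRed_out : ∀ c hc, Λ.IsRed (out c hc)
  isRed_back : ∀ c hc, Λ.IsRed (back c hc)
  deg_out_add : ∀ c hc, Λ.deg (out c hc) 1 + Λ.deg (back c hc) 1 = Λ.deg cycle 1

/-- Division with remainder: by uniqueness of red paths `f` can be peeled off `g`, and a nonzero
remainder would be a proper segment of `f` returning to `v`. -/
theorem IsCycle.length_dvd (hU : Λ.UniqueRed) {v : V} {f : v ⟶ v} (hr : Λ.IsRed f)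
    (hf : Λ.IsCycle f) (g : v ⟶ v) (hg : Λ.IsRed g) : Λ.deg f 1 ∣ Λ.deg g 1 := by
  have hpos : 0 < Λ.deg f 1 := Nat.pos_of_ne_zero fun h0 =>
    hf.1 (by rw [hr.deg_eq, h0]; simp)
  induction hm : Λ.deg g 1 using Nat.strong_induction_on generalizing g with
  | _ m ih =>
    rcases Nat.eq_zero_or_pos m with rfl | hm0
    · exact dvd_zero _
    rcases le_or_gt (Λ.deg f 1) m with hle | hlt
    · obtain ⟨c, ν, μ, hμ, hν, h⟩ := Λ.exists_factor g (Λ.deg f) ![0, m - Λ.deg f 1] (by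
        rw [hg.deg_eq, hr.deg_eq, hm]; funext i; fin_cases i
        · simp
        · simp; omega)
      have hμr : Λ.IsRed μ := by rw [IsRed, hμ]; exact hr
      cases hU.eq hμr hr (by rw [hμ])
      have := ih (m - Λ.deg f 1) (by omega) ν (by simp [IsRed, hν]) (by simp [hν])
      have := this.add (dvd_refl _)
      rwa [Nat.sub_add_cancel hle] at this
    · obtain ⟨c, ν, μ, hμ, hν, h⟩ := Λ.exists_factor f (Λ.deg g) ![0, Λ.deg f 1 - m] (by
        rw [hg.deg_eq, hr.deg_eq, hm]; funext i; fin_cases i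
        · simp
        · simp; omega)
      have hμr : Λ.IsRed μ := by rw [IsRed, hμ]; exact hg
      cases hU.eq hμr hg (by rw [hμ])
      refine absurd rfl (hf.2 v ν g h (Pi.lt_def.2 ⟨fun i => Nat.zero_le _, 1, ?_⟩)
        (Pi.lt_def.2 ⟨fun i => ?_, 1, ?_⟩))
      · rw [hm]; exact hm0
      · fin_cases i
        · exact (le_of_eq hg).trans (Nat.zero_le _)
        · exact hm ▸ hlt.le
      · rw [hm]; exact hlt

theorem exists_sourceCycle (hU : Λ.UniqueRed)
    (hsources : ∃ (v : V) (f : v ⟶ v), Λ.IsRed f ∧ Λ.IsIsolatedCycle f ∧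
      ∀ c ∈ Λ.blueSources, ∃ (ν : v ⟶ c) (μ : c ⟶ v), f = ν ≫ μ) :
    Nonempty Λ.SourceCycle := by
  obtain ⟨v, f, hr, hi, h⟩ := hsources
  choose ν μ hf using h
  have h0 : ∀ c hc, Λ.deg (μ c hc) 0 + Λ.deg (ν c hc) 0 = 0 := fun c hc => by
    rw [← deg_comp_apply, ← hf]; exact hr
  exact ⟨⟨v, f, hr, Nat.pos_of_ne_zero fun h0 => hi.1.1 (by rw [hr.deg_eq, h0]; simp),
    hi.1.length_dvd hU hr, ν, μ, fun c hc => (Nat.add_eq_zero_iff.1 (h0 c hc)).2,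
    fun c hc => (Nat.add_eq_zero_iff.1 (h0 c hc)).1,
    fun c hc => by rw [add_comm, ← deg_comp_apply, ← hf]⟩⟩

namespace SourceCycle

variable (C : Λ.SourceCycle)

/-- The length of the cycle. -/
def length : ℕ := Λ.deg C.cycle 1

/-- The distance from the source of `y` to the base of the cycle. -/
def pos {a : V} (y : Λ.SourcePath a) : ℕ := Λ.deg (C.back y.src y.src_mem) 1

/-- Close `ρ` up to a loop at the base using `out` and `back`. The length of `out` is the cycle
length minus `pos y`. -/
theorem length_dvd_red {a b : V} (y : Λ.SourcePath a) (z : Λ.SourcePath b) (ρ : y.src ⟶ z.src)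
    (hρ : Λ.IsRed ρ) : (C.length : ℤ) ∣ C.pos z + Λ.deg ρ 1 - C.pos y := by
  have h := C.dvd_of_closed (C.out _ y.src_mem ≫ ρ ≫ C.back _ z.src_mem)
    ((C.isRed_out _ _).comp (hρ.comp (C.isRed_back _ _)))
  have h2 := C.deg_out_add _ y.src_mem
  rw [deg_comp_apply, deg_comp_apply] at h
  have h3 : (C.length : ℤ) ∣ _ := Int.natCast_dvd_natCast.2 h
  have h4 := Int.dvd_sub h3 (Int.dvd_refl (C.length : ℤ))
  refine (congrArg _ ?_).mp h4
  unfold length pos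
  rw [← h2]; push_cast; ring

variable (hU : Λ.UniqueRed)

/-- The winding number of the red part of `f y`. -/
noncomputable def wt {a b : V} (f : a ⟶ b) (y : Λ.SourcePath a) : ℤ :=
  (C.pos (act hU f y) + Λ.deg f 1 - C.pos y) / C.length

theorem length_mul_wt {a b : V} (f : a ⟶ b) (y : Λ.SourcePath a) :
    C.length * C.wt hU f y = C.pos (act hU f y) + Λ.deg f 1 - C.pos y := by
  refine Int.mul_ediv_cancel' ?_
  rw [← deg_actRed hU f y]
  exact C.length_dvd_red y _ _ (isRed_actRed hU f y)

theorem length_ne_zero : (C.length : ℤ) ≠ 0 := Int.natCast_ne_zero.2 C.length_pos.ne'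

theorem wt_id {a : V} (y : Λ.SourcePath a) : C.wt hU (𝟙 a) y = 0 := by
  simp [wt, act_id, Λ.deg_id]

/-- The `pos` terms telescope. This cocycle identity is what makes the matrices multiplicative. -/
theorem wt_comp {a b c : V} (g : a ⟶ b) (f : b ⟶ c) (y : Λ.SourcePath a) :
    C.wt hU (g ≫ f) y = C.wt hU f (act hU g y) + C.wt hU g y := by
  refine mul_left_cancel₀ C.length_ne_zero ?_
  rw [mul_add, length_mul_wt, length_mul_wt, length_mul_wt, act_comp, deg_comp_apply]
  push_cast; ring

end SourceCycle

end KGraph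

/-! ### Products of sums of matrix units -/

section SumSingle

open Matrix

variable {α β I L : Type*} [Fintype α] [Fintype β] [Fintype I] [DecidableEq I] [Semiring L]

theorem sum_single_mul_eq_zero {p q : β → I} {c : β → L} {r s : α → I} {d : α → L}
    (h : ∀ z y, q z ≠ r y) :
    (∑ z, single (p z) (q z) (c z)) * (∑ y, single (r y) (s y) (d y)) = 0 := by
  simp_rw [Finset.sum_mul, Finset.mul_sum]
  exact Finset.sum_eq_zero fun z _ => Finset.sum_eq_zero fun y _ =>
    single_mul_single_of_ne _ _ _ _ (h z y) _

theorem sum_single_mul_right {p q : β → I} {c : β → L} {r s : α → I} {d : α → L}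
    (hq : Function.Injective q) (h : α → β) (hr : ∀ y, r y = q (h y)) :
    (∑ z, single (p z) (q z) (c z)) * (∑ y, single (r y) (s y) (d y)) =
      ∑ y, single (p (h y)) (s y) (c (h y) * d y) := by
  simp_rw [Finset.sum_mul, Finset.mul_sum]
  rw [Finset.sum_comm]
  refine Finset.sum_congr rfl fun y _ => ?_
  rw [Finset.sum_eq_single (h y)]
  · rw [hr y, single_mul_single_same]
  · intro z _ hz
    exact single_mul_single_of_ne _ _ _ _ (fun e => hz (hq (e.trans (hr y)))) _
  · simp

theorem sum_single_mul_left {p q : β → I} {c : β → L} {r s : α → I} {d : α → L}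
    (hr : Function.Injective r) (h : β → α) (hq : ∀ z, q z = r (h z)) :
    (∑ z, single (p z) (q z) (c z)) * (∑ y, single (r y) (s y) (d y)) =
      ∑ z, single (p z) (s (h z)) (c z * d (h z)) := by
  simp_rw [Finset.sum_mul, Finset.mul_sum]
  refine Finset.sum_congr rfl fun z _ => ?_
  rw [Finset.sum_eq_single (h z)]
  · rw [hq z, single_mul_single_same]
  · intro y _ hy
    exact single_mul_single_of_ne _ _ _ _ (fun e => hy (hr (e.symm.trans (hq z)))) _
  · simp

end SumSingle

/-! ### The matrix representation -/

namespace KGraph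

open Matrix LaurentPolynomial

variable {V : Type u} [Category.{w} V] {Λ : KGraph 2 V}

namespace SourceCycle

variable (C : Λ.SourceCycle) (hU : Λ.UniqueRed) (R : Type*) [CommRing R]

theorem sigma_act_injective {a b : V} (f : a ⟶ b) :
    Function.Injective fun y : Λ.SourcePath a =>
      (⟨b, act hU f y⟩ : Σ a, Λ.SourcePath a) :=
  sigma_mk_injective.comp (act_injective hU f)

variable [∀ a, Fintype (Λ.SourcePath a)] [DecidableEq (Σ a, Λ.SourcePath a)]

/-- The matrix of a path. -/
noncomputable def pathMatrix {a b : V} (f : a ⟶ b) :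
    Matrix (Σ a, Λ.SourcePath a) (Σ a, Λ.SourcePath a) R[T;T⁻¹] :=
  ∑ y : Λ.SourcePath a, single ⟨b, act hU f y⟩ ⟨a, y⟩ (T (C.wt hU f y))

/-- The matrix of a ghost path. -/
noncomputable def ghostMatrix {a b : V} (f : a ⟶ b) :
    Matrix (Σ a, Λ.SourcePath a) (Σ a, Λ.SourcePath a) R[T;T⁻¹] :=
  ∑ y : Λ.SourcePath a, single ⟨a, y⟩ ⟨b, act hU f y⟩ (T (-C.wt hU f y))

theorem pathMatrix_id (v : V) :
    C.pathMatrix hU R (𝟙 v) = ∑ y : Λ.SourcePath v, single ⟨v, y⟩ ⟨v, y⟩ 1 := by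
  simp [pathMatrix, act_id, wt_id]

theorem ghostMatrix_id (v : V) : C.ghostMatrix hU R (𝟙 v) = C.pathMatrix hU R (𝟙 v) := by
  simp [ghostMatrix, pathMatrix_id, act_id, wt_id]

variable [Fintype V]

theorem pathMatrix_mul_pathMatrix {a b c : V} (g : a ⟶ b) (f : b ⟶ c) :
    C.pathMatrix hU R f * C.pathMatrix hU R g = C.pathMatrix hU R (g ≫ f) := by
  unfold pathMatrix
  rw [sum_single_mul_right (sigma_mk_injective (i := b)) (act hU g) fun y => rfl]
  simp_rw [act_comp, wt_comp, T_add]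

theorem ghostMatrix_mul_ghostMatrix {a b c : V} (g : a ⟶ b) (f : b ⟶ c) :
    C.ghostMatrix hU R g * C.ghostMatrix hU R f = C.ghostMatrix hU R (g ≫ f) := by
  unfold ghostMatrix
  rw [sum_single_mul_left (sigma_mk_injective (i := b)) (act hU g) fun y => rfl]
  simp_rw [act_comp, wt_comp, neg_add_rev, T_add]

theorem ghostMatrix_mul_pathMatrix {a b : V} (f : a ⟶ b) :
    C.ghostMatrix hU R f * C.pathMatrix hU R f = C.pathMatrix hU R (𝟙 a) := by
  rw [pathMatrix_id]
  unfold ghostMatrix pathMatrix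
  rw [sum_single_mul_right (r := fun y => ⟨b, act hU f y⟩) (sigma_act_injective hU f)
    (fun y => y) fun y => rfl]
  refine Finset.sum_congr rfl fun y _ => ?_
  rw [← T_add, neg_add_cancel, T_zero]

theorem pathMatrix_mul_ghostMatrix {a b : V} (f : a ⟶ b) :
    C.pathMatrix hU R f * C.ghostMatrix hU R f =
      ∑ y : Λ.SourcePath a, single ⟨b, act hU f y⟩ ⟨b, act hU f y⟩ 1 := by
  unfold ghostMatrix pathMatrix
  rw [sum_single_mul_right (r := fun y => ⟨a, y⟩) (sigma_mk_injective (i := a)) (fun y => y) fun y => rfl]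
  refine Finset.sum_congr rfl fun y _ => ?_
  rw [← T_add, add_neg_cancel, T_zero]

theorem ghostMatrix_mul_pathMatrix_of_ne {n : Fin 2 → ℕ} {f g : Path V} (hf : f ∈ Λ.pathsLE n)
    (hg : g ∈ Λ.pathsLE n) (h : f ≠ g) :
    C.ghostMatrix hU R f.hom * C.pathMatrix hU R g.hom = 0 := by
  unfold ghostMatrix pathMatrix
  refine sum_single_mul_eq_zero fun y z e => ?_
  cases f
  cases g
  dsimp only at e
  obtain ⟨rfl, e⟩ := Sigma.mk.inj_iff.1 e
  exact h (congrArg Sigma.fst (eq_of_act_eq hU hf hg (eq_of_heq e)))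

theorem pathMatrix_id_mul_of_ne {v v' : V} (h : v ≠ v') :
    C.pathMatrix hU R (𝟙 v) * C.pathMatrix hU R (𝟙 v') = 0 := by
  unfold pathMatrix
  exact sum_single_mul_eq_zero fun y z e => h (congrArg Sigma.fst e)

/-- The map `(f, y) ↦ fy` is a bijection from pairs with `f` in `v Λ^{≤ n}` onto the source paths
with range `v`, so both sides are the same sum of diagonal matrix units. -/
theorem pathMatrix_id_eq_sum (v : V) (n : Fin 2 → ℕ) (h : (Λ.pathsLEAt v n).Finite) :
    C.pathMatrix hU R (𝟙 v) =
      ∑ f ∈ h.toFinset, C.pathMatrix hU R f.hom * C.ghostMatrix hU R f.hom := by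
  simp_rw [pathMatrix_mul_ghostMatrix, pathMatrix_id]
  rw [Finset.sum_sigma', ← Finset.sum_image (s := Finset.univ) (g := Sigma.mk v)
    (f := fun x => (single x x 1 : Matrix (Σ a, Λ.SourcePath a) (Σ a, Λ.SourcePath a) R[T;T⁻¹]))
    sigma_mk_injective.injOn]
  symm
  have hmem : ∀ p : (Σ f : Path V, Λ.SourcePath f.source),
      p ∈ h.toFinset.sigma (fun _ => Finset.univ) ↔ p.1 ∈ Λ.pathsLEAt v n := by simp
  refine Finset.sum_bij (fun p _ => ⟨p.1.range, act hU p.1.hom p.2⟩) ?_ ?_ ?_ fun _ _ => rfl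
  · rintro p hp
    obtain ⟨rfl, -⟩ := (hmem p).1 hp
    exact Finset.mem_image_of_mem _ (Finset.mem_univ _)
  · rintro ⟨f, y⟩ hp ⟨g, z⟩ hq e
    have hf := (hmem _).1 hp
    have hg := (hmem _).1 hq
    cases f
    cases g
    dsimp only at e
    obtain ⟨rfl, e⟩ := Sigma.mk.inj_iff.1 e
    exact eq_of_act_eq hU hf.2 hg.2 (eq_of_heq e)
  · intro x hx
    obtain ⟨x, -, rfl⟩ := Finset.mem_image.1 hx
    obtain ⟨a, f, y, hf, rfl⟩ := exists_act_eq hU x n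
    exact ⟨⟨⟨f⟩, y⟩, (hmem _).2 ⟨rfl, hf⟩, rfl⟩

/-- The values of the representation on letters. -/
noncomputable def letterMatrix :
    Letter V → Matrix (Σ a, Λ.SourcePath a) (Σ a, Λ.SourcePath a) R[T;T⁻¹]
  | .path f => C.pathMatrix hU R f
  | .ghost f => C.ghostMatrix hU R f

theorem lift_letterMatrix_eq {x y : FreeAlgebra R (Letter V)} (h : KPRel R Λ x y) :
    FreeAlgebra.lift R (C.letterMatrix hU R) x = FreeAlgebra.lift R (C.letterMatrix hU R) y := by
  have hS : ∀ {a b : V} (f : a ⟶ b),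
      FreeAlgebra.lift R (C.letterMatrix hU R) (freeS R f) = C.pathMatrix hU R f := fun f =>
    FreeAlgebra.lift_ι_apply _ _
  have hG : ∀ {a b : V} (f : a ⟶ b),
      FreeAlgebra.lift R (C.letterMatrix hU R) (freeG R f) = C.ghostMatrix hU R f := fun f =>
    FreeAlgebra.lift_ι_apply _ _
  have hP : ∀ v : V,
      FreeAlgebra.lift R (C.letterMatrix hU R) (freeP R v) = C.pathMatrix hU R (𝟙 v) := fun v =>
    FreeAlgebra.lift_ι_apply _ _
  cases h with
  | ghost_vertex v => rw [hG, hP, ghostMatrix_id]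
  | kp1_idem v => rw [map_mul, hP, pathMatrix_mul_pathMatrix, Category.comp_id]
  | kp1_orth v v' h => rw [map_mul, hP, hP, map_zero, pathMatrix_id_mul_of_ne _ _ _ h]
  | kp2_path g f => rw [map_mul, hS, hS, hS, pathMatrix_mul_pathMatrix]
  | kp2_ghost g f => rw [map_mul, hG, hG, hG, ghostMatrix_mul_ghostMatrix]
  | kp2_range_path f => rw [map_mul, hS, hP, pathMatrix_mul_pathMatrix, Category.comp_id]
  | kp2_path_source f => rw [map_mul, hS, hP, pathMatrix_mul_pathMatrix, Category.id_comp]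
  | kp2_source_ghost f =>
    rw [map_mul, hG, hP, ← ghostMatrix_id, ghostMatrix_mul_ghostMatrix, Category.id_comp]
  | kp2_ghost_range f =>
    rw [map_mul, hG, hP, ← ghostMatrix_id, ghostMatrix_mul_ghostMatrix, Category.comp_id]
  | kp3_eq n f hn hf => rw [map_mul, hG, hS, hP, ghostMatrix_mul_pathMatrix]
  | kp3_ne n f g hn hf hg h =>
    rw [map_mul, hG, hS, map_zero, ghostMatrix_mul_pathMatrix_of_ne _ _ _ hf hg h]
  | kp4 v n hn h =>
    rw [map_sum, hP, pathMatrix_id_eq_sum C hU R v n h]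
    simp_rw [map_mul, hG, hS]

/-- The representation of the Kumjian-Pask algebra by matrices. -/
noncomputable def rep : RingQuot (KPRel R Λ) →ₐ[R]
    Matrix (Σ a, Λ.SourcePath a) (Σ a, Λ.SourcePath a) R[T;T⁻¹] :=
  RingQuot.liftAlgHom R ⟨FreeAlgebra.lift R (C.letterMatrix hU R),
    fun _ _ h => C.lift_letterMatrix_eq hU R h⟩

end SourceCycle

end KGraph

/-! ### Consequences of the relations in the Kumjian-Pask algebra -/

namespace KGraph

open LaurentPolynomial

variable {V : Type u} [Category.{w} V] (Λ : KGraph 2 V) (R : Type*) [CommRing R]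

/-- The image of a path in the quotient of the free algebra. -/
noncomputable def pathElt {a b : V} (f : a ⟶ b) : RingQuot (KPRel R Λ) :=
  RingQuot.mkAlgHom R (KPRel R Λ) (freeS R f)

/-- The image of a ghost path in the quotient of the free algebra. -/
noncomputable def ghostElt {a b : V} (f : a ⟶ b) : RingQuot (KPRel R Λ) :=
  RingQuot.mkAlgHom R (KPRel R Λ) (freeG R f)

theorem pathElt_mem {a b : V} (f : a ⟶ b) : Λ.pathElt R f ∈ KumjianPask R Λ :=
  NonUnitalAlgebra.subset_adjoin R ⟨Letter.path f, rfl⟩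

theorem ghostElt_mem {a b : V} (f : a ⟶ b) : Λ.ghostElt R f ∈ KumjianPask R Λ :=
  NonUnitalAlgebra.subset_adjoin R ⟨Letter.ghost f, rfl⟩

theorem pathElt_mul {a b c : V} (g : a ⟶ b) (f : b ⟶ c) :
    Λ.pathElt R f * Λ.pathElt R g = Λ.pathElt R (g ≫ f) :=
  (map_mul _ _ _).symm.trans (RingQuot.mkAlgHom_rel R (KPRel.kp2_path g f))

theorem ghostElt_mul {a b c : V} (g : a ⟶ b) (f : b ⟶ c) :
    Λ.ghostElt R g * Λ.ghostElt R f = Λ.ghostElt R (g ≫ f) :=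
  (map_mul _ _ _).symm.trans (RingQuot.mkAlgHom_rel R (KPRel.kp2_ghost g f))

theorem ghostElt_id (v : V) : Λ.ghostElt R (𝟙 v) = Λ.pathElt R (𝟙 v) :=
  RingQuot.mkAlgHom_rel R (KPRel.ghost_vertex v)

theorem pathElt_mul_id {a b : V} (f : a ⟶ b) :
    Λ.pathElt R f * Λ.pathElt R (𝟙 a) = Λ.pathElt R f := by
  rw [pathElt_mul, Category.id_comp]

theorem id_mul_ghostElt {a b : V} (f : a ⟶ b) :
    Λ.pathElt R (𝟙 a) * Λ.ghostElt R f = Λ.ghostElt R f := by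
  rw [← ghostElt_id, ghostElt_mul, Category.id_comp]

theorem ghostElt_mul_pathElt_self {a b : V} (f : a ⟶ b) :
    Λ.ghostElt R f * Λ.pathElt R f = Λ.pathElt R (𝟙 a) := by
  -- The relation `kp3_eq` is applied with `n = d(f)` and demands `n ≠ 0`, so vertices are treated
  -- apart.
  by_cases h : Λ.deg f = 0
  · cases Λ.eq_id_of_deg_eq_zero f h
    rw [ghostElt_id, pathElt_mul, Category.comp_id]
  · exact (map_mul _ _ _).symm.trans (RingQuot.mkAlgHom_rel R
      (KPRel.kp3_eq (Λ.deg f) ⟨f⟩ h ⟨le_rfl, fun i hi => absurd hi (lt_irrefl _)⟩))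

theorem ghostElt_mul_pathElt_of_ne {n : Fin 2 → ℕ} (hn : n ≠ 0) {f g : Path V}
    (hf : f ∈ Λ.pathsLE n) (hg : g ∈ Λ.pathsLE n) (h : f ≠ g) :
    Λ.ghostElt R f.hom * Λ.pathElt R g.hom = 0 :=
  ((map_mul _ _ _).symm.trans (RingQuot.mkAlgHom_rel R
    (KPRel.kp3_ne n f g hn hf hg h))).trans (map_zero _)

theorem pathElt_id_eq_sum (v : V) {n : Fin 2 → ℕ} (hn : n ≠ 0) (h : (Λ.pathsLEAt v n).Finite) :
    Λ.pathElt R (𝟙 v) = ∑ f ∈ h.toFinset, Λ.pathElt R f.hom * Λ.ghostElt R f.hom := by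
  have := RingQuot.mkAlgHom_rel R (KPRel.kp4 (R := R) (Λ := Λ) v n hn h)
  rw [map_sum] at this
  simp_rw [map_mul] at this
  exact this

variable {Λ}

/-- By uniqueness of red paths `ρ` is the only element of `b Λ^{≤ d(ρ)}`, so the sum in `kp4` has
one term. -/
theorem pathElt_mul_ghostElt_of_red (hU : Λ.UniqueRed) {a b : V} {ρ : a ⟶ b} (hρ : Λ.IsRed ρ) :
    Λ.pathElt R ρ * Λ.ghostElt R ρ = Λ.pathElt R (𝟙 b) := by
  by_cases h0 : Λ.deg ρ = 0
  · cases Λ.eq_id_of_deg_eq_zero ρ h0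
    rw [ghostElt_id, pathElt_mul, Category.comp_id]
  · have h : Λ.pathsLEAt b (Λ.deg ρ) = {Path.mk ρ} := by
      ext f
      constructor
      · rintro ⟨rfl, hf⟩
        have h1 := deg_one_of_mem_pathsLE hU hf
        have h2 : Λ.IsRed f.hom := Nat.le_zero.1 ((hf.1 0).trans (le_of_eq hρ))
        cases f
        dsimp only at *
        cases hU.eq h2 hρ h1
        rfl
      · rintro rfl
        exact ⟨rfl, le_rfl, fun i hi => absurd hi (lt_irrefl _)⟩
    have hfin : (Λ.pathsLEAt b (Λ.deg ρ)).Finite := h ▸ Set.finite_singleton _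
    rw [Λ.pathElt_id_eq_sum R b h0 hfin]
    have : hfin.toFinset = {Path.mk ρ} := by ext; simp [h]
    rw [this, Finset.sum_singleton]

theorem pathElt_mul_ghostElt_cancel (hU : Λ.UniqueRed) {a b c d : V} {ρ : a ⟶ b}
    (hρ : Λ.IsRed ρ) (f : b ⟶ c) (g : b ⟶ d) :
    Λ.pathElt R (ρ ≫ f) * Λ.ghostElt R (ρ ≫ g) = Λ.pathElt R f * Λ.ghostElt R g := by
  rw [← pathElt_mul, ← ghostElt_mul, mul_assoc, ← mul_assoc (Λ.pathElt R ρ),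
    pathElt_mul_ghostElt_of_red R hU hρ, id_mul_ghostElt]

section BlueBound

variable [Fintype V] (hblue : ∀ (v : V) (f : v ⟶ v), Λ.IsBlue f → ¬ Λ.IsCycle f)

include hblue

/-- Blue lengths are at most `card V`, so the bound `card V + 1` is never attained and membership in
`Λ^{≤ n}` forces the source to be a blue source. -/
theorem SourcePath.mem_pathsLE {a : V} (y : Λ.SourcePath a) :
    Path.mk y.hom ∈ Λ.pathsLE ![Fintype.card V + 1, 0] := by
  refine ⟨fun i => ?_, fun i hi => ?_⟩
  · fin_cases i
    · exact (blue_length_le hblue y.hom y.blue).trans (Nat.le_succ _)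
    · exact le_of_eq y.blue
  · fin_cases i
    · exact y.src_mem
    · exact absurd hi (Nat.not_lt_zero _)

theorem ghostElt_mul_pathElt_sourcePath {a b : V} (y : Λ.SourcePath a) (z : Λ.SourcePath b)
    (h : (⟨a, y⟩ : Σ a, Λ.SourcePath a) ≠ ⟨b, z⟩) :
    Λ.ghostElt R y.hom * Λ.pathElt R z.hom = 0 := by
  refine Λ.ghostElt_mul_pathElt_of_ne R (fun h => by simpa using congrFun h 0)
    (y.mem_pathsLE hblue) (z.mem_pathsLE hblue) fun e => h ?_
  obtain ⟨s, y, _, _⟩ := y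
  obtain ⟨t, z, _, _⟩ := z
  cases e
  rfl

theorem pathElt_id_eq_sum_sourcePath (v : V) [Fintype (Λ.SourcePath v)] :
    Λ.pathElt R (𝟙 v) =
      ∑ y : Λ.SourcePath v, Λ.pathElt R y.hom * Λ.ghostElt R y.hom := by
  classical
  have himg : Λ.pathsLEAt v ![Fintype.card V + 1, 0] =
      Set.range fun y : Λ.SourcePath v => Path.mk y.hom := by
    ext f
    constructor
    · rintro ⟨rfl, hf⟩
      have hb : Λ.IsBlue f.hom := Nat.le_zero.1 (hf.1 1)
      exact ⟨⟨f.source, f.hom, hb,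
        hf.2 0 (Nat.lt_succ_of_le (blue_length_le hblue f.hom hb))⟩, rfl⟩
    · rintro ⟨y, rfl⟩
      exact ⟨rfl, y.mem_pathsLE hblue⟩
  have hfin : (Λ.pathsLEAt v ![Fintype.card V + 1, 0]).Finite := himg ▸ Set.finite_range _
  have hinj : Function.Injective fun y : Λ.SourcePath v => Path.mk y.hom := by
    rintro ⟨s, y, _, _⟩ ⟨t, z, _, _⟩ e
    cases e
    rfl
  rw [Λ.pathElt_id_eq_sum R v (fun h => by simpa using congrFun h 0) hfin]
  have : hfin.toFinset = Finset.univ.image fun y : Λ.SourcePath v => Path.mk y.hom := by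
    ext; simp [himg]
  rw [this, Finset.sum_image hinj.injOn]

end BlueBound

/-! ### Spanning by lifts of the matrix units -/

namespace SourceCycle

variable (C : Λ.SourceCycle)

/-- The path winding `j` times around the cycle and then reaching the range of `y` through `y`. -/
def windPath (j : ℕ) {a : V} (y : Λ.SourcePath a) : C.base ⟶ a :=
  loopPow C.cycle j ≫ C.out y.src y.src_mem ≫ y.hom

theorem windPath_add (i j : ℕ) {a : V} (y : Λ.SourcePath a) :
    C.windPath (i + j) y = loopPow C.cycle i ≫ C.windPath j y := by
  rw [windPath, loopPow_add, Category.assoc]; rfl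

theorem base_mem {a : V} (y : Λ.SourcePath a) : C.base ∈ Λ.blueSources :=
  blueSources_of_red_in (ρ := C.out y.src y.src_mem) y.src_mem

theorem exists_comp_eq_windPath (hU : Λ.UniqueRed) {s b : V} (hs : s ∈ Λ.blueSources)
    (f : s ⟶ b) :
    ∃ (j : ℕ) (y : Λ.SourcePath b), (C.cycle ≫ C.out s hs) ≫ f = C.windPath j y := by
  obtain ⟨⟨y, ρ⟩, hρ, h⟩ := exists_act hU f (SourcePath.id hs)
  change s ⟶ y.src at ρ
  replace h : f = ρ ≫ y.hom := (Category.id_comp f).symm.trans h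
  have hτ : Λ.IsRed ((C.cycle ≫ C.out s hs) ≫ ρ) :=
    (C.isRed_cycle.comp (C.isRed_out s hs)).comp hρ
  obtain ⟨j, hj⟩ := C.dvd_of_closed _ (hτ.comp (C.isRed_back y.src y.src_mem))
  have h1 := C.deg_out_add y.src y.src_mem
  have h2 := C.length_pos
  simp only [deg_comp_apply] at hj
  -- The full turn placed in front makes the multiple of the cycle length positive. One turn is then
  -- given up to account for `out` followed by `back` at the source of `y`.
  obtain _ | j := j
  · omega
  refine ⟨j, y, ?_⟩
  rw [h, ← Category.assoc, windPath, ← Category.assoc]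
  congr 1
  refine hU.eq_hom hτ ((isRed_loopPow C.isRed_cycle j).comp (C.isRed_out _ _)) ?_
  simp only [deg_comp_apply, deg_loopPow, Pi.smul_apply, smul_eq_mul]
  rw [mul_add, mul_one, mul_comm] at hj
  omega

/-- The preimage of the matrix with a single entry `x ^ k`. -/
noncomputable def unitElt (y z : Σ a, Λ.SourcePath a) (k : ℤ) : RingQuot (KPRel R Λ) :=
  Λ.pathElt R (C.windPath k.toNat y.2) * Λ.ghostElt R (C.windPath (-k).toNat z.2)

theorem unitElt_mem (y z : Σ a, Λ.SourcePath a) (k : ℤ) :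
    C.unitElt R y z k ∈ KumjianPask R Λ :=
  mul_mem (Λ.pathElt_mem R _) (Λ.ghostElt_mem R _)

theorem windPath_mul_windPath (hU : Λ.UniqueRed) (j l : ℕ) {a b : V} (y : Λ.SourcePath a)
    (z : Λ.SourcePath b) :
    Λ.pathElt R (C.windPath j y) * Λ.ghostElt R (C.windPath l z) =
      C.unitElt R ⟨a, y⟩ ⟨b, z⟩ (j - l) := by
  -- The `min j l` turns common to both paths cancel, leaving all winding on one side.
  have hj : j = min j l + ((j : ℤ) - l).toNat := by omega
  have hl : l = min j l + (-((j : ℤ) - l)).toNat := by omega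
  have hy := C.windPath_add (min j l) ((j : ℤ) - l).toNat y
  have hz := C.windPath_add (min j l) (-((j : ℤ) - l)).toNat z
  rw [← hj] at hy
  rw [← hl] at hz
  rw [hy, hz, pathElt_mul_ghostElt_cancel R hU (isRed_loopPow C.isRed_cycle _)]
  rfl

/-- The span of the elements `unitElt`. -/
noncomputable def unitSpan : Submodule R (RingQuot (KPRel R Λ)) :=
  Submodule.span R (Set.range fun p : (Σ a, Λ.SourcePath a) × (Σ a, Λ.SourcePath a) × ℤ =>
    C.unitElt R p.1 p.2.1 p.2.2)

/-- Inserting `τ τ* = s` between the factors, with `τ` red from the base to `s`, turns both into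
winding paths. -/
theorem mul_mem_unitSpan (hU : Λ.UniqueRed) {s b c : V} (hs : s ∈ Λ.blueSources) (f : s ⟶ b)
    (g : s ⟶ c) : Λ.pathElt R f * Λ.ghostElt R g ∈ C.unitSpan R := by
  obtain ⟨j, y, hy⟩ := C.exists_comp_eq_windPath hU hs f
  obtain ⟨l, z, hz⟩ := C.exists_comp_eq_windPath hU hs g
  rw [← pathElt_mul_ghostElt_cancel R hU (C.isRed_cycle.comp (C.isRed_out s hs)), hy, hz,
    windPath_mul_windPath R C hU]
  exact Submodule.subset_span ⟨(_, _, _), rfl⟩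

variable [Fintype V] (hblue : ∀ (v : V) (f : v ⟶ v), Λ.IsBlue f → ¬ Λ.IsCycle f)

include hblue

/-- If `z = z'`, the path with more turns absorbs the other in the middle product. Otherwise `z* z'
= 0`, as both lie in one `Λ^{≤ n}`. -/
theorem unitElt_mul_unitElt_mem (hU : Λ.UniqueRed) (y z z' w : Σ a, Λ.SourcePath a) (k l : ℤ) :
    C.unitElt R y z k * C.unitElt R z' w l ∈ C.unitSpan R := by
  have hassoc : C.unitElt R y z k * C.unitElt R z' w l =
      Λ.pathElt R (C.windPath k.toNat y.2) * (Λ.ghostElt R (C.windPath (-k).toNat z.2) *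
        Λ.pathElt R (C.windPath l.toNat z'.2)) * Λ.ghostElt R (C.windPath (-l).toNat w.2) := by
    simp only [unitElt, mul_assoc]
  rw [hassoc]
  by_cases h : z = z'
  · subst h
    rcases le_total (-k).toNat l.toNat with hle | hle
    · obtain ⟨i, hi⟩ := Nat.exists_eq_add_of_le' hle
      rw [hi, windPath_add, ← pathElt_mul, ← mul_assoc (Λ.ghostElt R _),
        ghostElt_mul_pathElt_self, pathElt_mul, Category.comp_id, pathElt_mul]
      exact C.mul_mem_unitSpan R hU (C.base_mem y.2) _ _
    · obtain ⟨i, hi⟩ := Nat.exists_eq_add_of_le' hle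
      rw [hi, windPath_add, ← ghostElt_mul, mul_assoc (Λ.ghostElt R _),
        ghostElt_mul_pathElt_self, ← ghostElt_id, ghostElt_mul, Category.comp_id, mul_assoc,
        ghostElt_mul]
      exact C.mul_mem_unitSpan R hU (C.base_mem y.2) _ _
  · have h0 := ghostElt_mul_pathElt_sourcePath R hblue z.2 z'.2 h
    have : Λ.ghostElt R (C.windPath (-k).toNat z.2) * Λ.pathElt R (C.windPath l.toNat z'.2)
        = 0 := by
      simp only [windPath, ← pathElt_mul, ← ghostElt_mul, mul_assoc]
      rw [← mul_assoc (Λ.ghostElt R z.2.hom), h0]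
      simp
    rw [this, mul_zero, zero_mul]
    exact zero_mem _

/-- Expanding the source vertex of `f` gives `f = ∑ (fy) y*`, where `fy` and `y` start at the same
blue source; ghosts are similar. -/
theorem le_unitSpan (hU : Λ.UniqueRed) [∀ a, Fintype (Λ.SourcePath a)]
    {x : RingQuot (KPRel R Λ)} (hx : x ∈ KumjianPask R Λ) : x ∈ C.unitSpan R := by
  induction hx using NonUnitalAlgebra.adjoin_induction with
  | mem x hx =>
    obtain ⟨f | f, rfl⟩ := hx
    · rename_i a b
      change Λ.pathElt R f ∈ _
      rw [← pathElt_mul_id, pathElt_id_eq_sum_sourcePath R hblue, Finset.mul_sum]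
      refine sum_mem fun y _ => ?_
      rw [← mul_assoc, pathElt_mul]
      exact C.mul_mem_unitSpan R hU y.src_mem _ _
    · rename_i a b
      change Λ.ghostElt R f ∈ _
      rw [← id_mul_ghostElt, pathElt_id_eq_sum_sourcePath R hblue, Finset.sum_mul]
      refine sum_mem fun y _ => ?_
      rw [mul_assoc, ghostElt_mul]
      exact C.mul_mem_unitSpan R hU y.src_mem _ _
  | add x y _ _ hx hy => exact add_mem hx hy
  | zero => exact zero_mem _
  | smul r x _ hx => exact Submodule.smul_mem _ r hx
  | mul x y _ _ hx hy =>
    have hxy := Submodule.mul_mem_mul hx hy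
    unfold unitSpan at hxy
    rw [Submodule.span_mul_span] at hxy
    refine Submodule.span_le.2 ?_ hxy
    rintro _ ⟨_, ⟨p, rfl⟩, _, ⟨q, rfl⟩, rfl⟩
    exact C.unitElt_mul_unitElt_mem R hblue hU _ _ _ _ _ _

end SourceCycle

end KGraph

/-! ### The isomorphism -/

namespace KGraph

open LaurentPolynomial

variable {V : Type u} [Category.{w} V] {Λ : KGraph 2 V} (R : Type*) [CommRing R]

namespace SourceCycle

variable (C : Λ.SourceCycle) (hU : Λ.UniqueRed)

theorem act_windPath (j : ℕ) {a : V} (y : Λ.SourcePath a) :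
    act hU (C.windPath j y) (SourcePath.id (C.base_mem y)) = y :=
  act_eq hU (ρ := loopPow C.cycle j ≫ C.out y.src y.src_mem)
    ((isRed_loopPow C.isRed_cycle j).comp (C.isRed_out _ _))
    ((Category.id_comp _).trans (Category.assoc _ _ _).symm)

theorem length_mul_wt_windPath (j : ℕ) {a : V} (y : Λ.SourcePath a) :
    C.length * C.wt hU (C.windPath j y) (SourcePath.id (C.base_mem y)) =
      C.length * (j + 1) - C.pos (SourcePath.id (C.base_mem y)) := by
  rw [length_mul_wt, act_windPath]
  -- Besides the `j` turns, `out` in the winding path and `back` in `pos y` add up to one more turn.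
  have h : C.pos y + Λ.deg (C.windPath j y) 1 = C.length * (j + 1) := by
    have h1 := C.deg_out_add y.src y.src_mem
    have h2 : Λ.deg y.hom 1 = 0 := y.blue
    simp only [windPath, deg_comp_apply, deg_loopPow, Pi.smul_apply, smul_eq_mul, pos, length]
    rw [← h1, h2]
    ring
  rw [← Nat.cast_add, h]
  push_cast
  ring

theorem wt_windPath_sub (j l : ℕ) {a b : V} (y : Λ.SourcePath a) (z : Λ.SourcePath b) :
    C.wt hU (C.windPath j y) (SourcePath.id (C.base_mem y)) -
      C.wt hU (C.windPath l z) (SourcePath.id (C.base_mem z)) = j - l := by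
  refine mul_left_cancel₀ C.length_ne_zero ?_
  rw [mul_sub, length_mul_wt_windPath, length_mul_wt_windPath]
  ring

variable [Fintype V] [∀ a, Fintype (Λ.SourcePath a)] [DecidableEq (Σ a, Λ.SourcePath a)]

theorem rep_pathElt {a b : V} (f : a ⟶ b) :
    C.rep hU R (Λ.pathElt R f) = C.pathMatrix hU R f :=
  (RingQuot.liftAlgHom_mkAlgHom_apply ..).trans (FreeAlgebra.lift_ι_apply _ _)

theorem rep_ghostElt {a b : V} (f : a ⟶ b) :
    C.rep hU R (Λ.ghostElt R f) = C.ghostMatrix hU R f :=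
  (RingQuot.liftAlgHom_mkAlgHom_apply ..).trans (FreeAlgebra.lift_ι_apply _ _)

theorem rep_unitElt (y z : Σ a, Λ.SourcePath a) (k : ℤ) :
    C.rep hU R (C.unitElt R y z k) = Matrix.single y z (T k) := by
  -- The base is a blue source, so its only source path is trivial and both matrices reduce to one
  -- entry.
  have hsub : Subsingleton (Λ.SourcePath C.base) :=
    ⟨fun p q => (p.eq_id (C.base_mem y.2)).trans (q.eq_id _).symm⟩
  rw [unitElt, map_mul, rep_pathElt, rep_ghostElt, pathMatrix, ghostMatrix,
    Fintype.sum_subsingleton _ (SourcePath.id (C.base_mem y.2)),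
    Fintype.sum_subsingleton _ (SourcePath.id (C.base_mem z.2)),
    Matrix.single_mul_single_same, ← T_add, ← sub_eq_add_neg, wt_windPath_sub, act_windPath,
    act_windPath]
  congr 2
  omega

/-- The linear map sending the matrix with a single entry `x ^ k` to `unitElt`. -/
noncomputable def repInv :
    Matrix (Σ a, Λ.SourcePath a) (Σ a, Λ.SourcePath a) R[T;T⁻¹] →ₗ[R] RingQuot (KPRel R Λ) :=
  Matrix.liftLinear R fun y z => (AddMonoidAlgebra.basis ℤ R).constr R (C.unitElt R y z)

theorem repInv_single (y z : Σ a, Λ.SourcePath a) (k : ℤ) :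
    C.repInv R (Matrix.single y z (T k)) = C.unitElt R y z k := by
  rw [repInv, Matrix.liftLinear_single]
  exact (AddMonoidAlgebra.basis ℤ R).constr_basis R (C.unitElt R y z) k

/-- By linearity the generators of the span suffice. This yields injectivity with no need for
`repInv` to be multiplicative. -/
theorem repInv_rep {x : RingQuot (KPRel R Λ)} (hx : x ∈ C.unitSpan R) :
    C.repInv R (C.rep hU R x) = x := by
  induction hx using Submodule.span_induction with
  | mem x hx =>
    obtain ⟨p, rfl⟩ := hx
    rw [rep_unitElt, repInv_single]
  | zero => simp
  | add x y _ _ hx hy => rw [map_add, map_add, hx, hy]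
  | smul r x _ hx => rw [map_smul, map_smul, hx]

theorem exists_rep_eq (m : Matrix (Σ a, Λ.SourcePath a) (Σ a, Λ.SourcePath a) R[T;T⁻¹]) :
    ∃ x ∈ KumjianPask R Λ, C.rep hU R x = m := by
  let P : Submodule R (Matrix (Σ a, Λ.SourcePath a) (Σ a, Λ.SourcePath a) R[T;T⁻¹]) :=
    (KumjianPask R Λ).toSubmodule.map (C.rep hU R).toLinearMap
  change m ∈ P
  rw [Matrix.matrix_eq_sum_single m]
  refine sum_mem fun y _ => sum_mem fun z _ => ?_
  have hspan := (AddMonoidAlgebra.basis ℤ R).mem_span (m y z)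
  change Matrix.singleLinearMap R y z (m y z) ∈ P
  rw [← Submodule.mem_comap]
  refine Submodule.span_le.2 ?_ hspan
  rintro _ ⟨k, rfl⟩
  exact ⟨C.unitElt R y z k, C.unitElt_mem R y z k, C.rep_unitElt R hU y z k⟩

/-- The isomorphism of the Kumjian-Pask algebra with a matrix algebra. -/
noncomputable def repEquiv (hblue : ∀ (v : V) (f : v ⟶ v), Λ.IsBlue f → ¬ Λ.IsCycle f) :
    KumjianPask R Λ ≃+* Matrix (Σ a, Λ.SourcePath a) (Σ a, Λ.SourcePath a) R[T;T⁻¹] where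
  toEquiv := Equiv.ofBijective (fun x : KumjianPask R Λ => C.rep hU R x) (by
    constructor
    · intro x y h
      have := congrArg (C.repInv R) h
      dsimp only at this
      rw [repInv_rep R C hU (C.le_unitSpan R hblue hU x.2),
        repInv_rep R C hU (C.le_unitSpan R hblue hU y.2)] at this
      exact Subtype.ext this
    · intro m
      obtain ⟨x, hx, rfl⟩ := C.exists_rep_eq R hU m
      exact ⟨⟨x, hx⟩, rfl⟩)
  map_mul' x y := map_mul (C.rep hU R) (x : RingQuot (KPRel R Λ)) y
  map_add' x y := map_add (C.rep hU R) (x : RingQuot (KPRel R Λ)) y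

end SourceCycle

/-- Blue paths from sources, sorted by their ranges. -/
def sourcePathEquiv (Λ : KGraph 2 V) : (Σ a, Λ.SourcePath a) ≃ Λ.bluePathsFromSources where
  toFun y := ⟨⟨y.2.hom⟩, y.2.blue, y.2.src_mem⟩
  invFun f := ⟨f.1.range, f.1.source, f.1.hom, f.2.1, f.2.2⟩
  left_inv _ := rfl
  right_inv _ := rfl

end KGraph

theorem proposition5p1 {V : Type u} [Category.{w} V] (Λ : KGraph 2 V) (R : Type*) [CommRing R]
    (hfin : Λ.IsFinite)
    (hblue : ∀ (v : V) (f : v ⟶ v), Λ.IsBlue f → ¬ Λ.IsCycle f)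
    (hred : ∀ v : V, ∃ f : v ⟶ v, Λ.IsRed f ∧ Λ.IsIsolatedCycle f)
    (hsources : ∃ (v : V) (f : v ⟶ v), Λ.IsRed f ∧ Λ.IsIsolatedCycle f ∧
      ∀ c ∈ Λ.blueSources, ∃ (ν : v ⟶ c) (μ : c ⟶ v), f = ν ≫ μ) :
    ∃ (_ : Fintype Λ.bluePathsFromSources)
      (φ : KGraph.KumjianPask R Λ ≃+*
        Matrix Λ.bluePathsFromSources Λ.bluePathsFromSources (LaurentPolynomial R)),
      ∀ (r : R) (x : KGraph.KumjianPask R Λ), φ (r • x) = r • φ x := by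
  classical
  have hU := KGraph.uniqueRed_of_isolated hred
  obtain ⟨C⟩ := KGraph.exists_sourceCycle hU hsources
  have := Λ.finite_vertices hfin
  have := Fintype.ofFinite V
  have := KGraph.finite_sourcePath hfin hblue
  have := fun a => Fintype.ofFinite (Λ.SourcePath a)
  let e := KGraph.sourcePathEquiv Λ
  let := Fintype.ofEquiv _ e
  refine ⟨inferInstance, (C.repEquiv R hU hblue).trans
    (Matrix.reindexAlgEquiv R (LaurentPolynomial R) e).toRingEquiv, fun r x => ?_⟩
  exact (congrArg (Matrix.reindexAlgEquiv R (LaurentPolynomial R) e)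
    (map_smul (C.rep hU R) r (x : RingQuot (KGraph.KPRel R Λ)))).trans (map_smul _ r _)
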